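/- Let $(\mathcal K,[\cdot,\cdot])$ be a (complex) Krein space, let $\|\cdot\|$ be a Banach space norm on $\mathcal K$ with respect to which $[\cdot,\cdot]$ is continuous, and let $T$ be a closed, densely defined linear operator in $\mathcal K$. Let $T^{[*]}$ be its adjoint with respect to $[\cdot,\cdot]$, and let $T^{[*]}T$ and $TT^{[*]}$ have their natural domains. For a linear operator $A$ in $\mathcal K$, $\rho(A)$ is the set of $\lambda\in\mathbb C$ for which $A-\lambda:\operatorname{dom}A\to\mathcal K$ is bijective with bounded inverse, and $\sigma(A)=\mathbb C\setminus\rho(A)$. A point $\lambda\in\sigma(A)$ of a selfadjoint operator $A=A^{[*]}$ is of positive (negative) type if there is a sequence $(x_n)\subset\operatorname{dom}A$ with $\|x_n\|=1$ and $(A-\lambda)x_n\to0$, and every such sequence satisfies $\liminf_n[x_n,x_n]>0$ (resp. $\limsup_n[x_n,x_n]<0$). A set $\Delta$ is of definite type with respect to $A$ if either all points of $\Delta\cap\sigma(A)$ are of positive type or all of them are of negative type. Let $\overline{\mathbb R}=\mathbb R\cup\{\infty\}\subset\overline{\mathbb C}=\mathbb C\cup\{\infty\}$ be the one-point compactifications,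 and let $\Omega\subset\overline{\mathbb C}$ be a domain (open and connected), symmetric with respect to $\overline{\mathbb R}$, with $\Omega\cap\mathbb R\neq\emptyset$ and such that $\Omega\cap\mathbb C^+$ and $\Omega\cap\mathbb C^-$ are simply connected. A selfadjoint operator $A$ in $\mathcal K$ is called definitizable over $\Omega$ if (i) $\sigma(A)\cap(\Omega\setminus\overline{\mathbb R})$ has no accumulation points in $\Omega$ and consists of poles of the resolvent of $A$; (ii) for each closed subset $\Delta$ of $\overline{\mathbb C}$ with $\Delta\subset\Omega\cap\overline{\mathbb R}$ there are an open neighbourhood $\mathcal U$ of $\Delta$ in $\overline{\mathbb C}$ and numbers $m\in\mathbb N$, $m\ge1$, and $M>0$ such that every $\lambda\in\mathcal U\setminus\overline{\mathbb R}$ belongs to $\rho(A)$ and $$\|(A-\lambda)^{-1}\|\le M\,\frac{(1+|\lambda|)^{2m-2}}{|\operatorname{Im}\lambda|^m};$$ (iii) each point $\lambda\in\Omega\cap\overline{\mathbb R}$ has an open connected neighbourhood $I_\lambda$ in $\overline{\mathbb R}$ such that, for each connected component $C$ of $I_\lambda\setminus\{\lambda\}$, the set $C\cap\mathbb R$ is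 of definite type with respect to $A$. Assume that both $T^{[*]}T$ and $TT^{[*]}$ have non-empty resolvent sets. Then $T^{[*]}T$ is definitizable over $\Omega$ if and only if $TT^{[*]}$ is definitizable over $\Omega$; here selfadjointness is understood as part of definitizability over $\Omega$. -/

import Mathlib

noncomputable section

namespace Krein

open Filter Topology

variable {K : Type*} [NormedAddCommGroup K] [NormedSpace ℂ K]

/-! ### Krein spaces -/

/-- `(P, [·,·])` is a Hilbert space: the form is positive definite on `P`, and `P` is complete
for the norm `[x,x]^{1/2}` (Cauchy sequences and limits are expressed through `[x,x]`). -/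
structure IsHilbertSubspace (B : K →ₗ⋆[ℂ] K →ₗ[ℂ] ℂ) (P : Submodule ℂ K) : Prop where
  pos : ∀ x ∈ P, x ≠ 0 → 0 < (B x x).re
  complete : ∀ u : ℕ → K, (∀ n, u n ∈ P) →
    (∀ ε > 0, ∃ N, ∀ m ≥ N, ∀ n ≥ N, (B (u m - u n) (u m - u n)).re < ε) →
    ∃ x ∈ P, Tendsto (fun n => (B (u n - x) (u n - x)).re) atTop (𝓝 0)

/-- `(K, [·,·])` is a Krein space with `[x,y] = B x y`, and the form is continuous for the given
norm of `K`: the form is Hermitian and `K` is the direct orthogonal sum of a Hilbert space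
`(P, [·,·])` and an anti-Hilbert space `(N, [·,·])`. -/
structure IsKreinForm (B : K →ₗ⋆[ℂ] K →ₗ[ℂ] ℂ) : Prop where
  hermitian : ∀ x y, B y x = (starRingEnd ℂ) (B x y)
  continuous : Continuous fun p : K × K => B p.1 p.2
  decomposition : ∃ P N : Submodule ℂ K, IsCompl P N ∧ (∀ x ∈ P, ∀ y ∈ N, B x y = 0) ∧
    IsHilbertSubspace B P ∧ IsHilbertSubspace (-B) N

/-! ### Unbounded operators -/

/-- The product `S T`, with its natural domain `{x ∈ dom T | T x ∈ dom S}`. -/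
def mul (S T : K →ₗ.[ℂ] K) : K →ₗ.[ℂ] K where
  domain := (S.domain.comap T.toFun).map T.domain.subtype
  toFun :=
    { toFun := fun x => S ⟨T ⟨x, by obtain ⟨x, y, hy, rfl⟩ := x; exact y.2⟩,
        by obtain ⟨x, y, hy, rfl⟩ := x; exact hy⟩
      map_add' := fun x y => by
        rw [← LinearPMap.map_add]
        congr 1
        ext
        simp only [Submodule.coe_add]
        rw [← LinearPMap.map_add]
        rfl
      map_smul' := fun c x => by
        rw [RingHom.id_apply, ← LinearPMap.map_smul]
        congr 1
        ext
        simp only [Submodule.coe_smul]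
        rw [← LinearPMap.map_smul]
        rfl }

/-- The graph `{(y, z) | [T x, y] = [x, z] for all x ∈ dom T}` of the adjoint of `T` with respect
to the form `B`. -/
def adjointGraph (B : K →ₗ⋆[ℂ] K →ₗ[ℂ] ℂ) (T : K →ₗ.[ℂ] K) : Submodule ℂ (K × K) where
  carrier := {p | ∀ x : T.domain, B (T x) p.1 = B x p.2}
  zero_mem' := fun x => by simp
  add_mem' := fun {p q} hp hq x => by simp [hp x, hq x]
  smul_mem' := fun c p hp x => by simp [hp x]

/-- The adjoint `T^{[*]}` of a densely defined operator `T` with respect to the form `B`. -/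
def adjoint (B : K →ₗ⋆[ℂ] K →ₗ[ℂ] ℂ) (T : K →ₗ.[ℂ] K) : K →ₗ.[ℂ] K :=
  (adjointGraph B T).toLinearPMap

/-- `A` is densely defined and `A^{[*]} = A`. -/
def IsSelfadjoint (B : K →ₗ⋆[ℂ] K →ₗ[ℂ] ℂ) (A : K →ₗ.[ℂ] K) : Prop :=
  Dense (A.domain : Set K) ∧ adjoint B A = A

/-- `R` is the bounded inverse, defined on all of `K`, of `A - z : dom A → K`. -/
def IsResolventAt (A : K →ₗ.[ℂ] K) (z : ℂ) (R : K →L[ℂ] K) : Prop :=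
  (∀ y, ∃ h : R y ∈ A.domain, A ⟨R y, h⟩ - z • R y = y) ∧
    ∀ x : A.domain, R (A x - z • (x : K)) = x

/-- The resolvent set `ρ(A)`. -/
def resolventSet (A : K →ₗ.[ℂ] K) : Set ℂ := {z | ∃ R : K →L[ℂ] K, IsResolventAt A z R}

/-- The spectrum `σ(A)`. -/
def spectrum (A : K →ₗ.[ℂ] K) : Set ℂ := (resolventSet A)ᶜ

open Classical in
/-- The resolvent `(A - z)⁻¹` for `z ∈ ρ(A)` (and `0` for `z ∈ σ(A)`). -/
def resolvent (A : K →ₗ.[ℂ] K) (z : ℂ) : K →L[ℂ] K :=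
  if h : ∃ R : K →L[ℂ] K, IsResolventAt A z R then h.choose else 0

/-- `z` is a pole of the resolvent of `A`: an isolated point of the spectrum at which the
resolvent has a pole (of some positive order). -/
def IsResolventPole (A : K →ₗ.[ℂ] K) (z : ℂ) : Prop :=
  z ∈ spectrum A ∧ (∀ᶠ w in 𝓝[≠] z, w ∈ resolventSet A) ∧
    MeromorphicAt (resolvent A) z ∧ meromorphicOrderAt (resolvent A) z < 0

/-- `(x n)` is a sequence of unit vectors in `dom A` with `(A - z) x n → 0`. -/
def IsApproxEigenseq (A : K →ₗ.[ℂ] K) (z : ℂ) (x : ℕ → A.domain) : Prop :=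
  (∀ n, ‖(x n : K)‖ = 1) ∧ Tendsto (fun n => A (x n) - z • (x n : K)) atTop (𝓝 0)

/-- The approximate point spectrum. -/
def approxPointSpectrum (A : K →ₗ.[ℂ] K) : Set ℂ := {z | ∃ x, IsApproxEigenseq A z x}

/-- The spectral points of positive type, `σ₊₊(A)`. -/
def posTypeSpectrum (B : K →ₗ⋆[ℂ] K →ₗ[ℂ] ℂ) (A : K →ₗ.[ℂ] K) : Set ℂ :=
  {z | z ∈ spectrum A ∧ z ∈ approxPointSpectrum A ∧ ∀ x, IsApproxEigenseq A z x →
    0 < liminf (fun n => (B (x n : K) (x n : K)).re) atTop}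

/-- The spectral points of negative type, `σ₋₋(A)`. -/
def negTypeSpectrum (B : K →ₗ⋆[ℂ] K →ₗ[ℂ] ℂ) (A : K →ₗ.[ℂ] K) : Set ℂ :=
  {z | z ∈ spectrum A ∧ z ∈ approxPointSpectrum A ∧ ∀ x, IsApproxEigenseq A z x →
    limsup (fun n => (B (x n : K) (x n : K)).re) atTop < 0}

/-- The set `Δ` is of positive type or of negative type with respect to `A`. -/
def IsOfDefiniteType (B : K →ₗ⋆[ℂ] K →ₗ[ℂ] ℂ) (A : K →ₗ.[ℂ] K) (Δ : Set ℂ) : Prop :=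
  Δ ∩ spectrum A ⊆ posTypeSpectrum B A ∨ Δ ∩ spectrum A ⊆ negTypeSpectrum B A

/-! ### Local definitizability -/

/-- The embedding of the extended real line `ℝ ∪ {∞}` into the extended plane `ℂ ∪ {∞}`. -/
def extReal : OnePoint ℝ → OnePoint ℂ := OnePoint.map (fun t : ℝ => (t : ℂ))

/-- The domains over which definitizability is considered: domains in the extended complex plane,
symmetric with respect to the extended real line, that meet `ℝ` and whose intersections with the
open upper and lower half-planes are simply connected. -/
structure IsAdmissibleDomain (Ω : Set (OnePoint ℂ)) : Prop where
  isOpen : IsOpen Ω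
  isConnected : IsConnected Ω
  symm : ∀ z : ℂ, (z : OnePoint ℂ) ∈ Ω → (((starRingEnd ℂ) z : ℂ) : OnePoint ℂ) ∈ Ω
  meets_real : ∃ t : ℝ, ((t : ℂ) : OnePoint ℂ) ∈ Ω
  upper : IsSimplyConnected {z : ℂ | (z : OnePoint ℂ) ∈ Ω ∧ 0 < z.im}
  lower : IsSimplyConnected {z : ℂ | (z : OnePoint ℂ) ∈ Ω ∧ z.im < 0}

/-- The selfadjoint operator `A` is definitizable over `Ω`. -/
structure IsDefinitizableOver (B : K →ₗ⋆[ℂ] K →ₗ[ℂ] ℂ) (A : K →ₗ.[ℂ] K)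
    (Ω : Set (OnePoint ℂ)) : Prop where
  selfadjoint : IsSelfadjoint B A
  /-- The non-real spectrum in `Ω` has no accumulation point in `Ω`. -/
  no_accPt : ∀ p ∈ Ω, ¬ AccPt p
    (𝓟 ((fun z : ℂ => (z : OnePoint ℂ)) '' spectrum A ∩ (Ω \ Set.range extReal)))
  /-- The non-real spectrum in `Ω` consists of poles of the resolvent. -/
  poles : ∀ z ∈ spectrum A, (z : OnePoint ℂ) ∈ Ω \ Set.range extReal → IsResolventPole A z
  /-- Growth of the resolvent near closed subsets of `Ω ∩ (ℝ ∪ {∞})`. -/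
  growth : ∀ Δ : Set (OnePoint ℂ), IsClosed Δ → Δ ⊆ Ω ∩ Set.range extReal →
    ∃ U : Set (OnePoint ℂ), IsOpen U ∧ Δ ⊆ U ∧ ∃ m : ℕ, 1 ≤ m ∧ ∃ M : ℝ, 0 < M ∧
      ∀ z : ℂ, (z : OnePoint ℂ) ∈ U \ Set.range extReal → z ∈ resolventSet A ∧
        ‖resolvent A z‖ ≤ M * ((1 + ‖z‖) ^ (2 * m - 2) / |z.im| ^ m)
  /-- Each point of `Ω ∩ (ℝ ∪ {∞})` has an open connected neighbourhood `I` in `ℝ ∪ {∞}` such that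
  each component of `I \ {point}` is of definite type. -/
  definite : ∀ p : OnePoint ℝ, extReal p ∈ Ω →
    ∃ I : Set (OnePoint ℝ), IsOpen I ∧ IsConnected I ∧ p ∈ I ∧
      ∀ q ∈ I \ {p}, IsOfDefiniteType B A
        {z : ℂ | ∃ t : ℝ, (t : ℂ) = z ∧ (t : OnePoint ℝ) ∈ connectedComponentIn (I \ {p}) q}

end Krein

end

/-!
Write `S = T^{[*]}`. Formally `(T S - z)⁻¹ = (T (S T - z)⁻¹ S - 1) / z`. The unbounded factors are
tamed by fixed points `ν ∈ ρ(S T)` and `μ ∈ ρ(T S)`: by the closed graph theorem `T (S T - ν)⁻¹` and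
`S (T S - μ)⁻¹` are bounded, and the resolvent equation turns the formula into one with bounded
operators only. So away from `0` the spectra and the poles of the resolvents agree, and the growth
exponent `m` changes by at most one.

If `(x_n)` is an approximate eigensequence of `T S` at `t ∈ ℝ \ {0}`, then `(S x_n)`, suitably
regularized, is one of `S T`, and `[S x_n, S x_n] = [T S x_n, x_n] ≈ t [x_n, x_n]`. The sign type
is therefore multiplied by the sign of `t`, which is constant on the components of a punctured
neighbourhood that avoids `0` and `∞`.

Selfadjointness is automatic: a symmetric operator whose resolvent set contains a conjugate pair
of points is selfadjoint, and the growth condition near a real point of `Ω` provides such a pair.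
-/

namespace Krein

open Filter Topology

variable {K : Type*} [NormedAddCommGroup K] [NormedSpace ℂ K]

/-! ### Products and resolvents through graphs -/

section Graph

variable {S T A : K →ₗ.[ℂ] K} {x y w : K} {z : ℂ} {R : K →L[ℂ] K}

theorem mem_graph_mul : (x, w) ∈ (mul S T).graph ↔ ∃ y, (x, y) ∈ T.graph ∧ (y, w) ∈ S.graph := by
  simp only [LinearPMap.mem_graph_iff]
  constructor
  · rintro ⟨⟨x', y, hy, rfl⟩, rfl, rfl⟩
    exact ⟨T y, ⟨y, rfl, rfl⟩, ⟨T y, hy⟩, rfl, rfl⟩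
  · rintro ⟨y, ⟨a, rfl, rfl⟩, b, hb, rfl⟩
    have ha : T a ∈ S.domain := hb ▸ b.2
    obtain rfl : b = ⟨T a, ha⟩ := Subtype.ext hb
    exact ⟨⟨a, a, ha, rfl⟩, rfl, rfl⟩

theorem mem_graph_left_of_mem_graph_mul (hxy : (x, y) ∈ T.graph) (hxw : (x, w) ∈ (mul S T).graph) :
    (y, w) ∈ S.graph := by
  obtain ⟨y', hxy', hyw⟩ := mem_graph_mul.1 hxw
  rwa [T.mem_graph_snd_inj hxy hxy' rfl]

theorem IsResolventAt.mem_graph (h : IsResolventAt A z R) (y : K) :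
    (R y, y + z • R y) ∈ A.graph := by
  obtain ⟨hy, e⟩ := h.1 y
  exact (LinearPMap.mem_graph_iff _).2 ⟨⟨R y, hy⟩, rfl, sub_eq_iff_eq_add.1 e⟩

theorem IsResolventAt.apply_sub_smul (h : IsResolventAt A z R) (hx : (x, w) ∈ A.graph) :
    R (w - z • x) = x := by
  obtain ⟨a, rfl, rfl⟩ := (LinearPMap.mem_graph_iff _).1 hx
  exact h.2 a

theorem isResolventAt_of_mem_graph (hR : ∀ y, (R y, y + z • R y) ∈ A.graph)
    (hinj : ∀ x, (x, z • x) ∈ A.graph → x = 0) : IsResolventAt A z R := by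
  refine ⟨fun y => ?_, fun x => sub_eq_zero.1 (hinj _ ?_)⟩
  · obtain ⟨⟨a, ha⟩, e, e'⟩ := (LinearPMap.mem_graph_iff _).1 (hR y)
    obtain rfl : a = R y := e
    exact ⟨ha, sub_eq_iff_eq_add.2 e'⟩
  · convert A.graph.sub_mem (hR (A x - z • (x : K))) (A.mem_graph x) using 1
    exact Prod.ext rfl (by simp only [Prod.snd_sub]; module)

theorem IsResolventAt.resolvent_eq (h : IsResolventAt A z R) : resolvent A z = R := by
  have hex : ∃ R : K →L[ℂ] K, IsResolventAt A z R := ⟨R, h⟩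
  rw [resolvent, dif_pos hex]
  ext y
  simpa only [add_sub_cancel_right] using hex.choose_spec.apply_sub_smul (h.mem_graph y)

theorem isResolventAt_resolvent (hz : z ∈ resolventSet A) :
    IsResolventAt A z (resolvent A z) := by
  obtain ⟨R, hR⟩ := hz
  rwa [hR.resolvent_eq]

theorem exists_clm_mem_graph [CompleteSpace K] (hT : T.IsClosable) (R : K →L[ℂ] K)
    (hR : ∀ y, ∃ w, (R y, w) ∈ T.graph) : ∃ F : K →L[ℂ] K, ∀ y, (R y, F y) ∈ T.graph := by
  choose f hf using hR
  obtain ⟨T', hT'⟩ := hT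
  have hle : ∀ {p}, p ∈ T.graph → p ∈ T'.graph := fun hp => hT' ▸ T.graph.le_topologicalClosure hp
  let g : K →ₗ[ℂ] K :=
    { toFun := f
      map_add' := fun x y => T.mem_graph_snd_inj (hf (x + y))
        (T.graph.add_mem (hf x) (hf y)) (map_add R x y)
      map_smul' := fun c x => T.mem_graph_snd_inj (hf (c • x))
        (T.graph.smul_mem c (hf x)) (map_smul R c x) }
  have hg : (g.graph : Set (K × K)) = (fun p : K × K => (R p.1, p.2)) ⁻¹' T'.graph := by
    ext ⟨x, y⟩
    simp only [SetLike.mem_coe, LinearMap.mem_graph_iff, Set.mem_preimage]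
    exact ⟨fun h => h ▸ hle (hf x), fun h => T'.mem_graph_snd_inj h (hle (hf x)) rfl⟩
  have hclosed : IsClosed (g.graph : Set (K × K)) := by
    rw [hg, ← hT']
    exact T.graph.isClosed_topologicalClosure.preimage (by fun_prop)
  exact ⟨ContinuousLinearMap.ofIsClosedGraph hclosed, hf⟩

end Graph

/-! ### The resolvents of `S T` and `T S` -/

/-- Resolvents `P = (S T - ν)⁻¹` and `Q = (T S - μ)⁻¹` of the two products together with the
bounded operators `F = T P` and `G = S Q`, which stand in for the unbounded factors `T` and `S`. -/
structure ResolventFactors (T S : K →ₗ.[ℂ] K) where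
  /-- A point of the resolvent set of `S T`. -/
  ν : ℂ
  /-- A point of the resolvent set of `T S`. -/
  μ : ℂ
  /-- The resolvent `(S T - ν)⁻¹`. -/
  P : K →L[ℂ] K
  /-- The resolvent `(T S - μ)⁻¹`. -/
  Q : K →L[ℂ] K
  /-- The bounded operator `T P`. -/
  F : K →L[ℂ] K
  /-- The bounded operator `S Q`. -/
  G : K →L[ℂ] K
  isResolventAt_P : IsResolventAt (mul S T) ν P
  isResolventAt_Q : IsResolventAt (mul T S) μ Q
  mem_graph_F : ∀ y, (P y, F y) ∈ T.graph
  mem_graph_G : ∀ y, (Q y, G y) ∈ S.graph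

theorem nonempty_resolventFactors [CompleteSpace K] {T S : K →ₗ.[ℂ] K} (hT : T.IsClosable)
    (hS : S.IsClosable) (hST : (resolventSet (mul S T)).Nonempty)
    (hTS : (resolventSet (mul T S)).Nonempty) : Nonempty (ResolventFactors T S) := by
  obtain ⟨ν, P, hP⟩ := hST
  obtain ⟨μ, Q, hQ⟩ := hTS
  obtain ⟨F, hF⟩ := exists_clm_mem_graph hT P fun y =>
    (mem_graph_mul.1 (hP.mem_graph y)).imp fun _ h => h.1
  obtain ⟨G, hG⟩ := exists_clm_mem_graph hS Q fun y =>
    (mem_graph_mul.1 (hQ.mem_graph y)).imp fun _ h => h.1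
  exact ⟨⟨ν, μ, P, Q, F, G, hP, hQ, hF, hG⟩⟩

namespace ResolventFactors

variable {T S : K →ₗ.[ℂ] K} {x w : K} {z : ℂ} {R : K →L[ℂ] K}

/-- The same operators with the roles of `T` and `S` exchanged. -/
def symm (h : ResolventFactors T S) : ResolventFactors S T :=
  ⟨h.μ, h.ν, h.Q, h.P, h.G, h.F, h.isResolventAt_Q, h.isResolventAt_P, h.mem_graph_G,
    h.mem_graph_F⟩

/-- The resolvent `(T S - z)⁻¹` expressed through `R = (S T - z)⁻¹`. It is the regularized form
`(μ Q + (z - μ) T R S Q) / z` of the formal identity `(T S - z)⁻¹ = (T R S - 1) / z`, in which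
`T R = F (1 + (z - ν) R)` and `S Q = G` are bounded. -/
noncomputable def swapResolvent (h : ResolventFactors T S) (z : ℂ) (R : K →L[ℂ] K) : K →L[ℂ] K :=
  (h.μ / z) • h.Q + ((z - h.μ) / z) • (h.F * (1 + (z - h.ν) • R) * h.G)

theorem mem_graph_of_mem_graph_mul (h : ResolventFactors T S) (hx : (x, w) ∈ (mul S T).graph) :
    (x, h.F (w - h.ν • x)) ∈ T.graph := by
  simpa only [h.isResolventAt_P.apply_sub_smul hx] using h.mem_graph_F (w - h.ν • x)

theorem mem_graph_resolvent (h : ResolventFactors T S) (hR : IsResolventAt (mul S T) z R) (y : K) :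
    (R y, h.F (y + (z - h.ν) • R y)) ∈ T.graph := by
  simpa only [add_sub_assoc, ← sub_smul] using h.mem_graph_of_mem_graph_mul (hR.mem_graph y)

theorem mem_graph_swapResolvent (h : ResolventFactors T S) (hz : z ≠ 0)
    (hR : IsResolventAt (mul S T) z R) (y : K) :
    (h.swapResolvent z R y, y + z • h.swapResolvent z R y) ∈ (mul T S).graph := by
  have hTR := h.mem_graph_resolvent hR (h.G y)
  have hSTR := mem_graph_left_of_mem_graph_mul hTR (hR.mem_graph (h.G y))
  have hTG := mem_graph_left_of_mem_graph_mul (h.mem_graph_G y) (h.isResolventAt_Q.mem_graph y)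
  have hS_val : (h.μ / z) • h.G y + ((z - h.μ) / z) • (h.G y + z • R (h.G y)) =
      h.G y + (z - h.μ) • R (h.G y) := by
    match_scalars <;> field_simp
    ring
  have hTS_val : y + z • h.swapResolvent z R y =
      (y + h.μ • h.Q y) + (z - h.μ) • h.F (h.G y + (z - h.ν) • R (h.G y)) := by
    simp only [swapResolvent, add_apply, smul_apply, mul_apply_eq_comp, one_apply_eq_self]
    match_scalars <;> field_simp
  refine mem_graph_mul.2 ⟨h.G y + (z - h.μ) • R (h.G y), ?_, ?_⟩
  · rw [← hS_val]
    exact S.graph.add_mem (S.graph.smul_mem _ (h.mem_graph_G y)) (S.graph.smul_mem _ hSTR)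
  · rw [hTS_val]
    exact T.graph.add_mem hTG (T.graph.smul_mem _ hTR)

end ResolventFactors

theorem eq_zero_of_mem_graph_mul_swap {T S : K →ₗ.[ℂ] K} {x : K} {z : ℂ} {R : K →L[ℂ] K}
    (hz : z ≠ 0) (hR : IsResolventAt (mul S T) z R) (hx : (x, z • x) ∈ (mul T S).graph) :
    x = 0 := by
  obtain ⟨y, hxy, hyx⟩ := mem_graph_mul.1 hx
  have hy : (y, z • y) ∈ (mul S T).graph := mem_graph_mul.2 ⟨_, hyx, S.graph.smul_mem z hxy⟩
  obtain rfl : y = 0 := by simpa only [sub_self, map_zero] using (hR.apply_sub_smul hy).symm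
  exact (smul_eq_zero.1 (T.graph_fst_eq_zero_snd hyx rfl)).resolve_left hz

namespace ResolventFactors

variable {T S : K →ₗ.[ℂ] K} {z : ℂ} {R : K →L[ℂ] K}

theorem isResolventAt_swapResolvent (h : ResolventFactors T S) (hz : z ≠ 0)
    (hR : IsResolventAt (mul S T) z R) : IsResolventAt (mul T S) z (h.swapResolvent z R) :=
  isResolventAt_of_mem_graph (h.mem_graph_swapResolvent hz hR)
    fun _ => eq_zero_of_mem_graph_mul_swap hz hR

theorem resolvent_eq (h : ResolventFactors T S) (hz : z ≠ 0) (hρ : z ∈ resolventSet (mul S T)) :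
    resolvent (mul T S) z = h.swapResolvent z (resolvent (mul S T) z) :=
  (h.isResolventAt_swapResolvent hz (isResolventAt_resolvent hρ)).resolvent_eq

theorem mem_resolventSet_iff (h : ResolventFactors T S) (hz : z ≠ 0) :
    z ∈ resolventSet (mul T S) ↔ z ∈ resolventSet (mul S T) :=
  ⟨fun hρ => ⟨_, h.symm.isResolventAt_swapResolvent hz (isResolventAt_resolvent hρ)⟩,
    fun hρ => ⟨_, h.isResolventAt_swapResolvent hz (isResolventAt_resolvent hρ)⟩⟩

theorem mem_spectrum_iff (h : ResolventFactors T S) (hz : z ≠ 0) :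
    z ∈ spectrum (mul T S) ↔ z ∈ spectrum (mul S T) :=
  not_congr (h.mem_resolventSet_iff hz)

/-! ### Growth and poles of the resolvent -/

theorem norm_swapResolvent_le (h : ResolventFactors T S) (z : ℂ) (R : K →L[ℂ] K) :
    ‖h.swapResolvent z R‖ ≤ ‖h.μ‖ / ‖z‖ * ‖h.Q‖ +
      ‖z - h.μ‖ / ‖z‖ * (‖h.F‖ * (1 + ‖z - h.ν‖ * ‖R‖) * ‖h.G‖) := by
  have hR : ‖1 + (z - h.ν) • R‖ ≤ 1 + ‖z - h.ν‖ * ‖R‖ :=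
    norm_add_le_of_le ContinuousLinearMap.norm_id_le (norm_smul _ _).le
  have hFG : ‖h.F * (1 + (z - h.ν) • R) * h.G‖ ≤
      ‖h.F‖ * (1 + ‖z - h.ν‖ * ‖R‖) * ‖h.G‖ :=
    norm_mul_le_of_le (norm_mul_le_of_le le_rfl hR) le_rfl
  refine norm_add_le_of_le ?_ ?_
  · rw [norm_smul, norm_div]
  · rw [norm_smul, norm_div]
    gcongr

theorem exists_norm_swapResolvent_le (h : ResolventFactors T S) :
    ∃ c : ℝ, 0 < c ∧ ∀ z : ℂ, ∀ R : K →L[ℂ] K,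
      ‖h.swapResolvent z R‖ ≤ c * ((1 + ‖z‖) / ‖z‖ * (1 + (1 + ‖z‖) * ‖R‖)) := by
  have hsub : ∀ a z : ℂ, ‖z - a‖ ≤ (1 + ‖a‖) * (1 + ‖z‖) := fun a z => by
    nlinarith [norm_sub_le z a, mul_nonneg (norm_nonneg a) (norm_nonneg z)]
  refine ⟨‖h.μ‖ * ‖h.Q‖ + (1 + ‖h.μ‖) * (‖h.F‖ * (1 + ‖h.ν‖) * ‖h.G‖) + 1, by positivity,
    fun z R => (h.norm_swapResolvent_le z R).trans ?_⟩
  set s := ‖z‖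
  set r := ‖R‖
  have hs : 0 ≤ s := norm_nonneg z
  have hr : 0 ≤ r := norm_nonneg R
  have hsr : 0 ≤ (1 + s) * r := by positivity
  have hQ : ‖h.μ‖ / s * ‖h.Q‖ ≤ ‖h.μ‖ * ‖h.Q‖ * ((1 + s) / s * (1 + (1 + s) * r)) := by
    have hone : 1 ≤ (1 + s) * (1 + (1 + s) * r) := by nlinarith
    calc ‖h.μ‖ / s * ‖h.Q‖ = ‖h.μ‖ * ‖h.Q‖ * (1 / s) := by ring
      _ ≤ ‖h.μ‖ * ‖h.Q‖ * ((1 + s) * (1 + (1 + s) * r) / s) := by gcongr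
      _ = _ := by ring
  have hR : 1 + ‖z - h.ν‖ * r ≤ (1 + ‖h.ν‖) * (1 + (1 + s) * r) := by
    nlinarith [mul_le_mul_of_nonneg_right (hsub h.ν z) hr, norm_nonneg h.ν]
  calc _ ≤ ‖h.μ‖ * ‖h.Q‖ * ((1 + s) / s * (1 + (1 + s) * r)) +
        (1 + ‖h.μ‖) * (1 + s) / s *
          (‖h.F‖ * ((1 + ‖h.ν‖) * (1 + (1 + s) * r)) * ‖h.G‖) := by
        gcongr
        exact hsub h.μ z
    _ = (‖h.μ‖ * ‖h.Q‖ + (1 + ‖h.μ‖) * (‖h.F‖ * (1 + ‖h.ν‖) * ‖h.G‖)) *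
          ((1 + s) / s * (1 + (1 + s) * r)) := by ring
    _ ≤ _ := mul_le_mul_of_nonneg_right (le_add_of_nonneg_right zero_le_one) (by positivity)

/-- Since `|Im z| ≤ |z|`, the factor `1 / z` in `swapResolvent` costs one power of `|Im z|`. -/
theorem exists_norm_resolvent_le (h : ResolventFactors T S) {m : ℕ} (hm : 1 ≤ m) {M : ℝ}
    (hM : 0 < M) : ∃ M' : ℝ, 0 < M' ∧ ∀ z : ℂ, z.im ≠ 0 → z ∈ resolventSet (mul S T) →
      ‖resolvent (mul S T) z‖ ≤ M * ((1 + ‖z‖) ^ (2 * m - 2) / |z.im| ^ m) →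
      ‖resolvent (mul T S) z‖ ≤ M' * ((1 + ‖z‖) ^ (2 * (m + 1) - 2) / |z.im| ^ (m + 1)) := by
  obtain ⟨k, rfl⟩ := Nat.exists_eq_add_of_le' hm
  obtain ⟨c, hc, hswap⟩ := h.exists_norm_swapResolvent_le
  refine ⟨c * (1 + M), by positivity, fun z hz hρ hle => ?_⟩
  rw [h.resolvent_eq (by rintro rfl; exact hz rfl) hρ, mul_assoc]
  refine (hswap z _).trans (mul_le_mul_of_nonneg_left ?_ hc.le)
  simp only [show 2 * (k + 1) - 2 = 2 * k by omega, show 2 * (k + 1 + 1) - 2 = 2 * k + 2 by omega]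
    at hle ⊢
  have ht : 0 < |z.im| := abs_pos.2 hz
  have hts : |z.im| ≤ ‖z‖ := Complex.abs_im_le_norm z
  set r := ‖resolvent (mul S T) z‖
  set s := ‖z‖
  set t := |z.im|
  have hone : 1 ≤ (1 + s) ^ (2 * k + 1) / t ^ (k + 1) := by
    rw [one_le_div (by positivity)]
    calc t ^ (k + 1) ≤ (1 + s) ^ (k + 1) := by gcongr; linarith
      _ ≤ (1 + s) ^ (2 * k + 1) := by gcongr <;> linarith
  calc (1 + s) / s * (1 + (1 + s) * r)
      ≤ (1 + s) / t * ((1 + s) ^ (2 * k + 1) / t ^ (k + 1) +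
          (1 + s) * (M * ((1 + s) ^ (2 * k) / t ^ (k + 1)))) := by gcongr
    _ = _ := by field_simp; ring

end ResolventFactors

theorem meromorphicAt_clm_comp {E E' : Type*} [NormedAddCommGroup E] [NormedSpace ℂ E]
    [NormedAddCommGroup E'] [NormedSpace ℂ E'] (L : E →L[ℂ] E') {f : ℂ → E} {z : ℂ}
    (hf : MeromorphicAt f z) : MeromorphicAt (fun w => L (f w)) z := by
  obtain ⟨n, hn⟩ := hf
  refine ⟨n, ?_⟩
  simpa only [Function.comp_def, map_smul] using (L.analyticAt _).comp hn

namespace ResolventFactors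

variable {T S : K →ₗ.[ℂ] K} {z : ℂ}

theorem meromorphicAt_swapResolvent (h : ResolventFactors T S) {R : ℂ → K →L[ℂ] K}
    (hR : MeromorphicAt R z) : MeromorphicAt (fun w => h.swapResolvent w (R w)) z := by
  have hsandwich : MeromorphicAt (fun w => h.F * (1 + (w - h.ν) • R w) * h.G) z := by
    refine meromorphicAt_clm_comp (ContinuousLinearMap.mulLeftRight ℂ (K →L[ℂ] K) h.F h.G)
      (f := fun w => 1 + (w - h.ν) • R w) ?_
    fun_prop
  unfold swapResolvent
  fun_prop

theorem tendsto_swapResolvent (h : ResolventFactors T S) (hz : z ≠ 0) {R : ℂ → K →L[ℂ] K}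
    {L : K →L[ℂ] K} (hR : Tendsto R (𝓝[≠] z) (𝓝 L)) :
    Tendsto (fun w => h.swapResolvent w (R w)) (𝓝[≠] z) (𝓝 (h.swapResolvent z L)) := by
  have hid : Tendsto (fun w : ℂ => w) (𝓝[≠] z) (𝓝 z) := tendsto_id.mono_left nhdsWithin_le_nhds
  exact ((tendsto_const_nhds.div hid hz).smul_const h.Q).add
    (((hid.sub_const h.μ).div hid hz).smul
      (((((hid.sub_const h.ν).smul hR).const_add 1).const_mul h.F).mul_const h.G))

theorem isResolventPole (h : ResolventFactors T S) (hz : z ≠ 0)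
    (hp : IsResolventPole (mul S T) z) : IsResolventPole (mul T S) z := by
  obtain ⟨hσ, hρ, hmero, hord⟩ := hp
  have hne : ∀ᶠ w in 𝓝[≠] z, w ≠ 0 := nhdsWithin_le_nhds (isOpen_ne.mem_nhds hz)
  have hρ' : ∀ᶠ w in 𝓝[≠] z, w ∈ resolventSet (mul T S) := by
    filter_upwards [hρ, hne] with w hw hw0 using (h.mem_resolventSet_iff hw0).2 hw
  have hmero' : MeromorphicAt (resolvent (mul T S)) z := by
    refine (h.meromorphicAt_swapResolvent hmero).congr ?_
    filter_upwards [hρ, hne] with w hw hw0 using (h.resolvent_eq hw0 hw).symm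
  refine ⟨(h.mem_spectrum_iff hz).2 hσ, hρ', hmero', ?_⟩
  by_contra hreg
  obtain ⟨L, hL⟩ := (tendsto_nhds_iff_meromorphicOrderAt_nonneg hmero').2 (not_lt.1 hreg)
  have hST : Tendsto (resolvent (mul S T)) (𝓝[≠] z) (𝓝 (h.symm.swapResolvent z L)) := by
    refine (h.symm.tendsto_swapResolvent hz hL).congr' ?_
    filter_upwards [hρ', hne] with w hw hw0 using (h.symm.resolvent_eq hw0 hw).symm
  exact hord.not_ge ((tendsto_nhds_iff_meromorphicOrderAt_nonneg hmero).1 ⟨_, hST⟩)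

end ResolventFactors

/-! ### Spectral points of definite type -/

/-- `T` and `S` are formal adjoints of each other with respect to `[·,·]`: `[T x, y] = [x, S y]` on
the domains. -/
def IsFormalAdjoint (B : K →ₗ⋆[ℂ] K →ₗ[ℂ] ℂ) (T S : K →ₗ.[ℂ] K) : Prop :=
  ∀ (x : T.domain) (y : S.domain), B (T x) y = B x (S y)

/-- The points `z` of `σ(A)` which have approximate eigensequences, and such that `ε [x_n, x_n]` is
eventually bounded below by a positive constant along each of them. For `ε > 0` these are the
points of positive type, for `ε < 0` those of negative type; with a real parameter instead of a
sign, multiplying `ε` by `t` describes the effect of exchanging the factors of `S T`. -/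
def signTypeSpectrum (B : K →ₗ⋆[ℂ] K →ₗ[ℂ] ℂ) (ε : ℝ) (A : K →ₗ.[ℂ] K) : Set ℂ :=
  {z | z ∈ spectrum A ∧ z ∈ approxPointSpectrum A ∧ ∀ x, IsApproxEigenseq A z x →
    ∃ c > 0, ∀ᶠ n in atTop, c ≤ ε * (B (x n : K) (x n : K)).re}

section Form

variable {B : K →ₗ⋆[ℂ] K →ₗ[ℂ] ℂ}

theorem IsFormalAdjoint.apply_eq_of_mem_graph {T S : K →ₗ.[ℂ] K} (h : IsFormalAdjoint B T S)
    {x u y v : K} (hx : (x, u) ∈ T.graph) (hy : (y, v) ∈ S.graph) : B u y = B x v := by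
  obtain ⟨x, rfl, rfl⟩ := (LinearPMap.mem_graph_iff _).1 hx
  obtain ⟨y, rfl, rfl⟩ := (LinearPMap.mem_graph_iff _).1 hy
  exact h x y

theorem IsFormalAdjoint.symm {T S : K →ₗ.[ℂ] K} (hB : IsKreinForm B)
    (h : IsFormalAdjoint B T S) : IsFormalAdjoint B S T := fun x y => by
  rw [hB.hermitian, ← h, ← hB.hermitian]

theorem IsFormalAdjoint.mul_self {T S : K →ₗ.[ℂ] K} (hB : IsKreinForm B)
    (h : IsFormalAdjoint B T S) : IsFormalAdjoint B (mul S T) (mul S T) := fun x y => by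
  obtain ⟨u, hxu, hux⟩ := mem_graph_mul.1 ((mul S T).mem_graph x)
  obtain ⟨v, hyv, hvy⟩ := mem_graph_mul.1 ((mul S T).mem_graph y)
  rw [(h.symm hB).apply_eq_of_mem_graph hux hyv, h.apply_eq_of_mem_graph hxu hvy]

theorem IsKreinForm.exists_bound (hB : IsKreinForm B) :
    ∃ c : ℝ, 0 < c ∧ ∀ x y, ‖B x y‖ ≤ c * ‖x‖ * ‖y‖ := by
  have hnhds : ∀ᶠ p in 𝓝 (0 : K × K), ‖B p.1 p.2‖ < 1 :=
    hB.continuous.norm.continuousAt.eventually_lt_const (by simp)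
  obtain ⟨r, hr, hball⟩ := Metric.nhds_basis_closedBall.eventually_iff.1 hnhds
  have hright : ∀ x ∈ Metric.closedBall (0 : K) r, ∀ y, ‖B x y‖ ≤ 1 / r * ‖y‖ := fun x hx =>
    LinearMap.bound_of_ball_bound' hr 1 (B x) fun y hy =>
      (@hball (x, y) (by rw [← Prod.mk_zero_zero, ← closedBall_prod_same]; exact ⟨hx, hy⟩)).le
  refine ⟨1 / r / r, by positivity, fun x y => ?_⟩
  have hleft := LinearMap.bound_of_ball_bound' hr (1 / r * ‖x‖) (B x) fun y hy => by
    rw [hB.hermitian y x, RCLike.norm_conj]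
    exact hright y hy x
  exact (hleft y).trans_eq (by ring)

theorem IsKreinForm.tendsto_sub (hB : IsKreinForm B) {a a' b b' : ℕ → K} {r : ℝ}
    (ha : ∀ n, ‖a n‖ ≤ r) (hb : ∀ n, ‖b n‖ ≤ r) (haa' : Tendsto (fun n => a' n - a n) atTop (𝓝 0))
    (hbb' : Tendsto (fun n => b' n - b n) atTop (𝓝 0)) :
    Tendsto (fun n => B (a' n) (b' n) - B (a n) (b n)) atTop (𝓝 0) := by
  obtain ⟨c, hc, hbound⟩ := hB.exists_bound
  have hexpand : ∀ n, B (a' n) (b' n) - B (a n) (b n) =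
      B (a' n - a n) (b' n - b n) + B (a' n - a n) (b n) + B (a n) (b' n - b n) := fun n => by
    simp only [map_sub, LinearMap.sub_apply]
    ring
  have hlim : Tendsto (fun n => c * ‖a' n - a n‖ * ‖b' n - b n‖ + c * ‖a' n - a n‖ * r +
      c * r * ‖b' n - b n‖) atTop (𝓝 0) := by
    have haa'_norm := haa'.norm.const_mul c
    simpa using ((haa'_norm.mul hbb'.norm).add (haa'_norm.mul_const r)).add
      (hbb'.norm.const_mul (c * r))
  refine squeeze_zero_norm (fun n => ?_) hlim
  rw [hexpand n]
  refine norm_add₃_le.trans (add_le_add_three (hbound _ _) ((hbound _ _).trans ?_)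
    ((hbound _ _).trans ?_))
  · gcongr
    exact hb n
  · gcongr
    exact ha n

end Form

section SignType

variable {B : K →ₗ⋆[ℂ] K →ₗ[ℂ] ℂ} {A : K →ₗ.[ℂ] K} {z : ℂ}

theorem exists_isApproxEigenseq {y v : ℕ → K} (hy : ∀ n, (y n, v n) ∈ A.graph)
    (hv : Tendsto (fun n => v n - z • y n) atTop (𝓝 0)) {δ : ℝ} (hδ : 0 < δ)
    (hle : ∀ n, δ ≤ ‖y n‖) :
    ∃ x : ℕ → A.domain, IsApproxEigenseq A z x ∧ ∀ n, (x n : K) = (‖y n‖⁻¹ : ℂ) • y n := by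
  have hne : ∀ n, y n ≠ 0 := fun n => norm_pos_iff.1 (hδ.trans_le (hle n))
  have hgraph : ∀ n, ((‖y n‖⁻¹ : ℂ) • y n, (‖y n‖⁻¹ : ℂ) • v n) ∈ A.graph := fun n =>
    A.graph.smul_mem _ (hy n)
  have hdom : ∀ n, (‖y n‖⁻¹ : ℂ) • y n ∈ A.domain := fun n =>
    LinearPMap.mem_domain_of_mem_graph (hgraph n)
  have hA : ∀ n, A ⟨_, hdom n⟩ - z • (‖y n‖⁻¹ : ℂ) • y n = (‖y n‖⁻¹ : ℂ) • (v n - z • y n) :=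
    fun n => by
      rw [A.mem_graph_snd_inj (A.mem_graph ⟨_, hdom n⟩) (hgraph n) rfl]
      module
  refine ⟨fun n => ⟨_, hdom n⟩, ⟨fun n => norm_smul_inv_norm (hne n), ?_⟩, fun _ => rfl⟩
  simp only [hA]
  refine squeeze_zero_norm (fun n => ?_)
    (by simpa using (tendsto_zero_iff_norm_tendsto_zero.1 hv).const_mul δ⁻¹)
  rw [norm_smul, norm_inv, Complex.norm_real, norm_norm]
  gcongr
  exact hle n

theorem mem_approxPointSpectrum_of_tendsto {y v : ℕ → K} (hy : ∀ n, (y n, v n) ∈ A.graph)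
    (hv : Tendsto (fun n => v n - z • y n) atTop (𝓝 0)) {δ : ℝ} (hδ : 0 < δ)
    (hle : ∀ᶠ n in atTop, δ ≤ ‖y n‖) : z ∈ approxPointSpectrum A := by
  obtain ⟨N, hN⟩ := eventually_atTop.1 hle
  obtain ⟨x, hx, -⟩ := exists_isApproxEigenseq (fun n => hy (n + N))
    (hv.comp (tendsto_add_atTop_nat N)) hδ fun n => hN _ (Nat.le_add_left N n)
  exact ⟨x, hx⟩

theorem exists_le_form_of_mem_signTypeSpectrum {ε : ℝ} (hz : z ∈ signTypeSpectrum B ε A)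
    {y v : ℕ → K} (hy : ∀ n, (y n, v n) ∈ A.graph)
    (hv : Tendsto (fun n => v n - z • y n) atTop (𝓝 0)) {δ : ℝ} (hδ : 0 < δ)
    (hle : ∀ᶠ n in atTop, δ ≤ ‖y n‖) :
    ∃ c > 0, ∀ᶠ n in atTop, c ≤ ε * (B (y n) (y n)).re := by
  obtain ⟨N, hN⟩ := eventually_atTop.1 hle
  obtain ⟨x, hx, hxy⟩ := exists_isApproxEigenseq (fun n => hy (n + N))
    (hv.comp (tendsto_add_atTop_nat N)) hδ fun n => hN _ (Nat.le_add_left N n)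
  obtain ⟨c, hc, hev⟩ := hz.2.2 x hx
  refine ⟨δ ^ 2 * c, by positivity, ?_⟩
  rw [← map_add_atTop_eq_nat N, eventually_map]
  filter_upwards [hev] with n hn
  have hδy : δ ≤ ‖y (n + N)‖ := hN _ (Nat.le_add_left N n)
  have hyx : y (n + N) = (‖y (n + N)‖ : ℂ) • (x n : K) := by
    rw [hxy, smul_inv_smul₀ (by exact_mod_cast (hδ.trans_le hδy).ne')]
  have hform : (B (y (n + N)) (y (n + N))).re =
      ‖y (n + N)‖ ^ 2 * (B (x n : K) (x n : K)).re := by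
    conv_lhs => rw [hyx]
    rw [map_smul, map_smulₛₗ, Complex.conj_ofReal, LinearMap.smul_apply, smul_eq_mul, smul_eq_mul,
      Complex.re_ofReal_mul, Complex.re_ofReal_mul]
    ring
  calc δ ^ 2 * c ≤ ‖y (n + N)‖ ^ 2 * (ε * (B (x n : K) (x n : K)).re) := by gcongr
    _ = ε * (B (y (n + N)) (y (n + N))).re := by rw [hform]; ring

theorem signTypeSpectrum_subset {ε ε' : ℝ} (h : 0 < ε * ε') :
    signTypeSpectrum B ε A ⊆ signTypeSpectrum B ε' A := by
  rintro z ⟨hσ, hap, hsign⟩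
  refine ⟨hσ, hap, fun x hx => ?_⟩
  obtain ⟨c, hc, hev⟩ := hsign x hx
  have hε : ε ≠ 0 := left_ne_zero_of_mul h.ne'
  have hq : 0 < ε' / ε := by
    rw [← mul_div_mul_left ε' ε hε]
    exact div_pos h (mul_self_pos.2 hε)
  refine ⟨ε' / ε * c, mul_pos hq hc, hev.mono fun n hn => ?_⟩
  calc ε' / ε * c ≤ ε' / ε * (ε * (B (x n : K) (x n : K)).re) := by gcongr
    _ = ε' * (B (x n : K) (x n : K)).re := by field_simp

theorem liminf_pos_iff_of_abs_le {u : ℕ → ℝ} {r : ℝ} (hu : ∀ n, |u n| ≤ r) :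
    0 < liminf u atTop ↔ ∃ c > 0, ∀ᶠ n in atTop, c ≤ u n := by
  have hb : IsBoundedUnder (· ≥ ·) atTop u := isBoundedUnder_of ⟨-r, fun n => (abs_le.1 (hu n)).1⟩
  have hc : IsBoundedUnder (· ≤ ·) atTop u := isBoundedUnder_of ⟨r, fun n => (abs_le.1 (hu n)).2⟩
  constructor
  · intro h
    obtain ⟨c, hc0, hc1⟩ := exists_between h
    exact ⟨c, hc0, (eventually_lt_of_lt_liminf hc1 hb).mono fun _ => le_of_lt⟩
  · rintro ⟨c, hc0, hev⟩
    exact hc0.trans_le (le_liminf_of_le hc.isCoboundedUnder_ge hev)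

theorem limsup_neg_iff_of_abs_le {u : ℕ → ℝ} {r : ℝ} (hu : ∀ n, |u n| ≤ r) :
    limsup u atTop < 0 ↔ ∃ c > 0, ∀ᶠ n in atTop, c ≤ -u n := by
  have hb : IsBoundedUnder (· ≥ ·) atTop u := isBoundedUnder_of ⟨-r, fun n => (abs_le.1 (hu n)).1⟩
  have hc : IsBoundedUnder (· ≤ ·) atTop u := isBoundedUnder_of ⟨r, fun n => (abs_le.1 (hu n)).2⟩
  constructor
  · intro h
    obtain ⟨c, hc0, hc1⟩ := exists_between h
    exact ⟨-c, neg_pos.2 hc1, (eventually_lt_of_limsup_lt hc0 hc).mono fun _ hn =>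
      neg_le_neg hn.le⟩
  · rintro ⟨c, hc0, hev⟩
    exact (limsup_le_of_le hb.isCoboundedUnder_le (hev.mono fun _ => le_neg_of_le_neg)).trans_lt
      (neg_neg_of_pos hc0)

theorem IsKreinForm.exists_abs_re_le (hB : IsKreinForm B) {x : ℕ → A.domain}
    (hx : IsApproxEigenseq A z x) : ∃ r, ∀ n, |(B (x n : K) (x n : K)).re| ≤ r := by
  obtain ⟨c, -, hc⟩ := hB.exists_bound
  refine ⟨c, fun n => (Complex.abs_re_le_norm _).trans ?_⟩
  simpa only [hx.1 n, mul_one] using hc (x n) (x n)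

theorem IsKreinForm.posTypeSpectrum_eq (hB : IsKreinForm B) (A : K →ₗ.[ℂ] K) :
    posTypeSpectrum B A = signTypeSpectrum B 1 A := by
  ext z
  refine and_congr_right fun _ => and_congr_right fun _ => forall₂_congr fun x hx => ?_
  obtain ⟨r, hr⟩ := hB.exists_abs_re_le hx
  simpa only [one_mul] using liminf_pos_iff_of_abs_le hr

theorem IsKreinForm.negTypeSpectrum_eq (hB : IsKreinForm B) (A : K →ₗ.[ℂ] K) :
    negTypeSpectrum B A = signTypeSpectrum B (-1) A := by
  ext z
  refine and_congr_right fun _ => and_congr_right fun _ => forall₂_congr fun x hx => ?_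
  obtain ⟨r, hr⟩ := hB.exists_abs_re_le hx
  simpa only [neg_one_mul] using limsup_neg_iff_of_abs_le hr

theorem IsKreinForm.isOfDefiniteType_iff (hB : IsKreinForm B) {Δ : Set ℂ} :
    IsOfDefiniteType B A Δ ↔ ∃ ε : ℝ, ε ≠ 0 ∧ Δ ∩ spectrum A ⊆ signTypeSpectrum B ε A := by
  rw [IsOfDefiniteType, hB.posTypeSpectrum_eq, hB.negTypeSpectrum_eq]
  constructor
  · rintro (h | h)
    exacts [⟨1, one_ne_zero, h⟩, ⟨-1, neg_ne_zero.2 one_ne_zero, h⟩]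
  · rintro ⟨ε, hε, h⟩
    rcases hε.lt_or_gt with hneg | hpos
    · exact .inr (h.trans (signTypeSpectrum_subset (by linarith)))
    · exact .inl (h.trans (signTypeSpectrum_subset (by linarith)))

theorem IsOfDefiniteType.mono {Δ Δ' : Set ℂ} (h : IsOfDefiniteType B A Δ) (hΔ : Δ' ⊆ Δ) :
    IsOfDefiniteType B A Δ' :=
  h.imp (Set.inter_subset_inter_left _ hΔ).trans (Set.inter_subset_inter_left _ hΔ).trans

end SignType

theorem exists_le_norm_of_tendsto_sub {E E' : Type*} [NormedAddCommGroup E] [NormedSpace ℂ E]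
    [NormedAddCommGroup E'] [NormedSpace ℂ E'] (L : E →L[ℂ] E') {y : ℕ → E} {w : ℕ → E'} {r : ℝ}
    (hr : 0 < r) (hw : ∀ n, r ≤ ‖w n‖) (h : Tendsto (fun n => L (y n) - w n) atTop (𝓝 0)) :
    ∃ δ > 0, ∀ᶠ n in atTop, δ ≤ ‖y n‖ := by
  refine ⟨r / 2 / (‖L‖ + 1), by positivity, ?_⟩
  filter_upwards [(tendsto_zero_iff_norm_tendsto_zero.1 h).eventually_lt_const (half_pos hr)]
    with n hn
  rw [div_le_iff₀ (by positivity)]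
  have hLy : r - r / 2 ≤ ‖L (y n)‖ := by
    linarith [hw n, norm_sub_norm_le (w n) (L (y n)), norm_sub_rev (w n) (L (y n))]
  linarith [L.le_opNorm (y n), norm_nonneg (y n)]

namespace ResolventFactors

variable {B : K →ₗ⋆[ℂ] K →ₗ[ℂ] ℂ} {T S : K →ₗ.[ℂ] K} {x u : K}

/-- The bounded operator `(z - μ) S (T S - μ)⁻¹`, which coincides with `S` on the eigenvectors of
`T S` to the eigenvalue `z`, and approximately so on approximate eigenvectors. -/
noncomputable def eigenMap (h : ResolventFactors T S) (z : ℂ) : K →L[ℂ] K := (z - h.μ) • h.G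

theorem mem_graph_eigenMap (h : ResolventFactors T S) (z : ℂ) (hx : (x, u) ∈ (mul T S).graph) :
    (x - h.Q (u - z • x), h.eigenMap z x) ∈ S.graph := by
  have hQ : x - h.Q (u - z • x) = (z - h.μ) • h.Q x := by
    nth_rw 1 [← h.isResolventAt_Q.apply_sub_smul hx]
    simp only [map_sub, map_smul]
    module
  rw [hQ]
  exact S.graph.smul_mem _ (h.mem_graph_G x)

theorem eigenMap_mem_graph (h : ResolventFactors T S) (z : ℂ) (hx : (x, u) ∈ (mul T S).graph) :
    (h.eigenMap z x, z • x - h.μ • h.Q (u - z • x)) ∈ T.graph := by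
  have hT := T.graph.smul_mem (z - h.μ)
    (mem_graph_left_of_mem_graph_mul (h.mem_graph_G x) (h.isResolventAt_Q.mem_graph x))
  convert hT using 1
  refine Prod.ext rfl ?_
  have hQ := h.isResolventAt_Q.apply_sub_smul hx
  simp only [map_sub, map_smul] at hQ ⊢
  rw [sub_eq_iff_eq_add] at hQ
  rw [hQ]
  simp only [Prod.smul_mk]
  module

theorem eigenMap_mem_graph_mul (h : ResolventFactors T S) (z : ℂ)
    (hx : (x, u) ∈ (mul T S).graph) :
    (h.eigenMap z x, z • h.eigenMap z x + h.eigenMap z (u - z • x)) ∈ (mul S T).graph := by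
  refine mem_graph_mul.2 ⟨_, h.eigenMap_mem_graph z hx, ?_⟩
  convert S.graph.add_mem (S.graph.smul_mem z (h.mem_graph_eigenMap z hx))
    (S.graph.smul_mem (z - h.μ) (h.mem_graph_G (u - z • x))) using 1
  refine Prod.ext ?_ rfl
  simp only [Prod.smul_mk, Prod.mk_add_mk]
  module

section Approx

variable {z : ℂ} {x : ℕ → (mul T S).domain}

theorem exists_le_norm_eigenMap (h : ResolventFactors T S) (hz : z ≠ 0)
    (hx : IsApproxEigenseq (mul T S) z x) :
    ∃ δ > 0, ∀ᶠ n in atTop, δ ≤ ‖h.eigenMap z (x n)‖ := by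
  refine exists_le_norm_of_tendsto_sub ((z - h.ν) • h.F) (w := fun n => z • (x n : K))
    (norm_pos_iff.2 hz) (fun n => by rw [norm_smul, hx.1, mul_one]) ?_
  have hdefect : ∀ n, ((z - h.ν) • h.F) (h.eigenMap z (x n)) - z • (x n : K) =
      -(h.μ • h.Q + h.F * h.eigenMap z) (mul T S (x n) - z • (x n : K)) := fun n => by
    have hg := (mul T S).mem_graph (x n)
    have hF := T.mem_graph_snd_inj (h.mem_graph_of_mem_graph_mul (h.eigenMap_mem_graph_mul z hg))
      (h.eigenMap_mem_graph z hg) rfl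
    simp only [map_sub, map_add, map_smul, add_apply, smul_apply, mul_apply_eq_comp] at hF ⊢
    linear_combination (norm := module) hF
  simp only [hdefect]
  exact ((-(h.μ • h.Q + h.F * h.eigenMap z)).continuous.tendsto' 0 0 (map_zero _)).comp hx.2

theorem tendsto_eigenMap_sub (h : ResolventFactors T S) (hx : IsApproxEigenseq (mul T S) z x) :
    Tendsto (fun n => (z • h.eigenMap z (x n) + h.eigenMap z (mul T S (x n) - z • (x n : K))) -
      z • h.eigenMap z (x n)) atTop (𝓝 0) := by
  simp only [add_sub_cancel_left]
  exact ((h.eigenMap z).continuous.tendsto' 0 0 (map_zero _)).comp hx.2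

theorem tendsto_form_eigenMap (h : ResolventFactors T S) (hB : IsKreinForm B)
    (hTS : IsFormalAdjoint B T S) {t : ℝ} (hx : IsApproxEigenseq (mul T S) t x) :
    Tendsto (fun n => (B (h.eigenMap t (x n)) (h.eigenMap t (x n))).re -
      t * (B (x n : K) (x n : K)).re) atTop (𝓝 0) := by
  set d : ℕ → K := fun n => mul T S (x n) - (t : ℂ) • (x n : K)
  have hform : ∀ n, B (h.eigenMap t (x n)) (h.eigenMap t (x n)) =
      B ((t : ℂ) • (x n : K) - h.μ • h.Q (d n)) (x n - h.Q (d n)) := fun n =>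
    (hTS.apply_eq_of_mem_graph (h.eigenMap_mem_graph t ((mul T S).mem_graph (x n)))
      (h.mem_graph_eigenMap t ((mul T S).mem_graph (x n)))).symm
  have hQ : Tendsto (fun n => h.Q (d n)) atTop (𝓝 0) :=
    (h.Q.continuous.tendsto' 0 0 (map_zero _)).comp hx.2
  have hlim := hB.tendsto_sub (r := 1 + |t|)
    (a := fun n => (t : ℂ) • (x n : K)) (a' := fun n => (t : ℂ) • (x n : K) - h.μ • h.Q (d n))
    (b := fun n => (x n : K)) (b' := fun n => (x n : K) - h.Q (d n))
    (fun n => by simp [norm_smul, hx.1 n]) (fun n => by simp [hx.1 n])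
    (by simpa using (hQ.const_smul h.μ).neg) (by simpa using hQ.neg)
  refine ((Complex.continuous_re.tendsto 0).comp hlim).congr fun n => ?_
  rw [Function.comp_apply, ← hform, Complex.sub_re, map_smulₛₗ, Complex.conj_ofReal,
    LinearMap.smul_apply, smul_eq_mul, Complex.re_ofReal_mul]

end Approx

theorem mem_signTypeSpectrum (h : ResolventFactors T S) (hB : IsKreinForm B)
    (hTS : IsFormalAdjoint B T S) {ε t : ℝ} (ht : t ≠ 0)
    (hz : (t : ℂ) ∈ signTypeSpectrum B ε (mul S T)) :
    (t : ℂ) ∈ signTypeSpectrum B (ε * t) (mul T S) := by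
  have ht' : (t : ℂ) ≠ 0 := Complex.ofReal_ne_zero.2 ht
  refine ⟨(h.mem_spectrum_iff ht').2 hz.1, ?_, fun x hx => ?_⟩
  · obtain ⟨x, hx⟩ := hz.2.1
    obtain ⟨δ, hδ, hle⟩ := h.symm.exists_le_norm_eigenMap ht' hx
    exact mem_approxPointSpectrum_of_tendsto
      (fun n => h.symm.eigenMap_mem_graph_mul t ((mul S T).mem_graph (x n)))
      (h.symm.tendsto_eigenMap_sub hx) hδ hle
  · obtain ⟨δ, hδ, hle⟩ := h.exists_le_norm_eigenMap ht' hx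
    obtain ⟨c, hc, hform⟩ := exists_le_form_of_mem_signTypeSpectrum hz
      (fun n => h.eigenMap_mem_graph_mul t ((mul T S).mem_graph (x n)))
      (h.tendsto_eigenMap_sub hx) hδ hle
    have hlim := (h.tendsto_form_eigenMap hB hTS hx).const_mul ε
    rw [mul_zero] at hlim
    refine ⟨c / 2, half_pos hc, ?_⟩
    filter_upwards [hform, hlim.eventually_lt_const (half_pos hc)] with n hn hn'
    linarith

theorem isOfDefiniteType (h : ResolventFactors T S) (hB : IsKreinForm B)
    (hTS : IsFormalAdjoint B T S) {s : Set ℝ} (hs : ∀ a ∈ s, ∀ b ∈ s, 0 < a * b)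
    (hdef : IsOfDefiniteType B (mul S T) ((↑) '' s)) :
    IsOfDefiniteType B (mul T S) ((↑) '' s) := by
  rw [hB.isOfDefiniteType_iff] at hdef ⊢
  obtain ⟨ε, hε, hsub⟩ := hdef
  rcases s.eq_empty_or_nonempty with rfl | ⟨a, ha⟩
  · exact ⟨ε, hε, by simp⟩
  have hne : ∀ b ∈ s, b ≠ 0 := fun b hb => left_ne_zero_of_mul (hs b hb b hb).ne'
  refine ⟨ε * a, mul_ne_zero hε (hne a ha), ?_⟩
  rintro _ ⟨⟨b, hb, rfl⟩, hσ⟩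
  have hσ' := (h.mem_spectrum_iff (Complex.ofReal_ne_zero.2 (hne b hb))).1 hσ
  have hsign : 0 < ε * b * (ε * a) := by
    nlinarith [hs a ha b hb, mul_pos (mul_self_pos.2 hε) (hs a ha b hb)]
  exact signTypeSpectrum_subset hsign
    (h.mem_signTypeSpectrum hB hTS (hne b hb) (hsub ⟨⟨b, hb, rfl⟩, hσ'⟩))

end ResolventFactors

/-! ### The Riesz representation theorem in Krein spaces -/

theorem exists_linearEquiv_hilbert.{u} {E : Type u} [AddCommGroup E] [Module ℂ E]
    (b : E →ₗ⋆[ℂ] E →ₗ[ℂ] ℂ) (herm : ∀ x y, b y x = (starRingEnd ℂ) (b x y))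
    (hpos : ∀ x, x ≠ 0 → 0 < (b x x).re)
    (hcomplete : ∀ u : ℕ → E,
      (∀ ε > 0, ∃ N, ∀ m ≥ N, ∀ n ≥ N, (b (u m - u n) (u m - u n)).re < ε) →
      ∃ x, Tendsto (fun n => (b (u n - x) (u n - x)).re) atTop (𝓝 0)) :
    ∃ (H : Type u) (_ : NormedAddCommGroup H) (_ : InnerProductSpace ℂ H) (_ : CompleteSpace H)
      (e : E ≃ₗ[ℂ] H), ∀ x y, inner ℂ (e x) (e y) = b x y := by
  have hnonneg : ∀ x, 0 ≤ (b x x).re := fun x => by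
    rcases eq_or_ne x 0 with rfl | hx
    · rw [map_zero, Complex.zero_re]
    · exact (hpos x hx).le
  let core : InnerProductSpace.Core ℂ E :=
    { inner := fun x y => b x y
      conj_inner_symm := fun x y => (herm y x).symm
      re_inner_nonneg := hnonneg
      add_left := fun x y z => b.map_add₂ x y z
      smul_left := fun x y r => b.map_smulₛₗ₂ r x y
      definite := fun x hx => of_not_not fun h => (hpos x h).ne' (by rw [hx, Complex.zero_re]) }
  let _ : NormedAddCommGroup E := core.toNormedAddCommGroup
  let _ : InnerProductSpace ℂ E := InnerProductSpace.ofCore core.toCore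
  have hnorm : ∀ x : E, ‖x‖ ^ 2 = (b x x).re := fun x => (inner_self_eq_norm_sq (𝕜 := ℂ) x).symm
  have hcs : CompleteSpace E := by
    refine Metric.complete_of_cauchySeq_tendsto fun u hu => ?_
    obtain ⟨x, hx⟩ := hcomplete u fun ε hε => by
      obtain ⟨N, hN⟩ := Metric.cauchySeq_iff.1 hu (√ε) (Real.sqrt_pos.2 hε)
      refine ⟨N, fun m hm n hn => ?_⟩
      rw [← hnorm, ← Real.lt_sqrt (norm_nonneg _), ← dist_eq_norm]
      exact hN m hm n hn
    refine ⟨x, tendsto_iff_norm_sub_tendsto_zero.2 ?_⟩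
    simpa only [← hnorm, Real.sqrt_sq (norm_nonneg _), Real.sqrt_zero] using hx.sqrt
  exact ⟨E, _, _, hcs, LinearEquiv.refl ℂ E, fun _ _ => rfl⟩

theorem exists_repr_of_linearEquiv {E H : Type*} [NormedAddCommGroup E] [NormedSpace ℂ E]
    [CompleteSpace E] [NormedAddCommGroup H] [InnerProductSpace ℂ H] [CompleteSpace H]
    (e : E ≃ₗ[ℂ] H) {c : ℝ} (he : ∀ x, ‖e x‖ ≤ c * ‖x‖) (f : E →L[ℂ] ℂ) :
    ∃ y, ∀ x, f x = inner ℂ (e y) (e x) := by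
  let e' : E ≃L[ℂ] H := e.toContinuousLinearEquivOfContinuous
    (AddMonoidHomClass.continuous_of_bound e c he)
  let v : H := (InnerProductSpace.toDual ℂ H).symm (f ∘L (e'.symm : H →L[ℂ] E))
  refine ⟨e.symm v, fun x => ?_⟩
  have hv : inner ℂ v (e x) = f (e'.symm (e x)) := InnerProductSpace.toDual_symm_apply
  rw [e.apply_symm_apply, hv]
  exact congrArg f (e'.symm_apply_apply x).symm

section KreinSpace

variable {B : K →ₗ⋆[ℂ] K →ₗ[ℂ] ℂ} {P N : Submodule ℂ K}

theorem IsHilbertSubspace.eq_zero (hP : IsHilbertSubspace B P) {x : K} (hx : x ∈ P)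
    (h : B x x = 0) : x = 0 :=
  of_not_not fun hne => (hP.pos x hx hne).ne' (by rw [h, Complex.zero_re])

theorem IsKreinForm.isClosed_of_isCompl (hB : IsKreinForm B) (hPN : IsCompl P N)
    (horth : ∀ x ∈ P, ∀ y ∈ N, B x y = 0) (hN : IsHilbertSubspace (-B) N) :
    IsClosed (P : Set K) := by
  have hP_eq : (P : Set K) = ⋂ y ∈ N, {x | B x y = 0} := by
    ext x
    simp only [SetLike.mem_coe, Set.mem_iInter, Set.mem_ofPred_eq]
    refine ⟨fun hx y hy => horth x hx y hy, fun hx => ?_⟩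
    obtain ⟨p, n, hp, hn, rfl⟩ := Submodule.codisjoint_iff_exists_add_eq.1 hPN.codisjoint x
    have hnn : B n n = 0 := by
      simpa only [map_add, LinearMap.add_apply, horth p hp n hn, zero_add] using hx n hn
    rw [hN.eq_zero hn (by simp [hnn]), add_zero]
    exact hp
  rw [hP_eq]
  exact isClosed_biInter fun y _ =>
    isClosed_eq (hB.continuous.comp (Continuous.prodMk_left y)) continuous_const

theorem IsKreinForm.exists_repr_on_hilbertSubspace [CompleteSpace K] (hB : IsKreinForm B)
    (hPN : IsCompl P N) (horth : ∀ x ∈ P, ∀ y ∈ N, B x y = 0) (hP : IsHilbertSubspace B P)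
    (hN : IsHilbertSubspace (-B) N) (f : K →L[ℂ] ℂ) : ∃ p ∈ P, ∀ x ∈ P, f x = B p x := by
  have : CompleteSpace P := (hB.isClosed_of_isCompl hPN horth hN).completeSpace_coe
  obtain ⟨H, _, _, _, e, he⟩ := exists_linearEquiv_hilbert (B.domRestrict₁₂ P P)
    (fun x y => hB.hermitian x y) (fun x hx => hP.pos x x.2 fun h => hx (Subtype.ext h))
    fun u hu => by
      obtain ⟨x, hx, hlim⟩ := hP.complete (fun n => u n) (fun n => (u n).2) hu
      exact ⟨⟨x, hx⟩, hlim⟩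
  obtain ⟨c, hc, hbound⟩ := hB.exists_bound
  have hnorm : ∀ x, ‖e x‖ ≤ √c * ‖x‖ := fun x => by
    refine le_of_sq_le_sq ?_ (by positivity)
    calc ‖e x‖ ^ 2 = (B x x).re := by
          rw [← inner_self_eq_norm_sq (𝕜 := ℂ), he]
          rfl
      _ ≤ ‖B x x‖ := Complex.re_le_norm _
      _ ≤ c * ‖x‖ * ‖x‖ := hbound x x
      _ = (√c * ‖x‖) ^ 2 := by rw [mul_pow, Real.sq_sqrt hc.le]; ring
  obtain ⟨p, hp⟩ := exists_repr_of_linearEquiv e hnorm (f ∘L P.subtypeL)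
  exact ⟨p, p.2, fun x hx => (hp ⟨x, hx⟩).trans (he p ⟨x, hx⟩)⟩

theorem IsKreinForm.neg (hB : IsKreinForm B) : IsKreinForm (-B) where
  hermitian x y := by simp [hB.hermitian x y]
  continuous := hB.continuous.neg
  decomposition := by
    obtain ⟨P, N, hPN, horth, hP, hN⟩ := hB.decomposition
    refine ⟨N, P, hPN.symm, fun x hx y hy => ?_, hN, by rwa [neg_neg]⟩
    simp [hB.hermitian y x, horth y hy x hx]

theorem IsKreinForm.exists_repr [CompleteSpace K] (hB : IsKreinForm B) (f : K →L[ℂ] ℂ) :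
    ∃ y, ∀ x, f x = B y x := by
  obtain ⟨P, N, hPN, horth, hP, hN⟩ := hB.decomposition
  have horth' : ∀ x ∈ N, ∀ y ∈ P, B x y = 0 := fun x hx y hy => by
    rw [hB.hermitian y x, horth y hy x hx, map_zero]
  obtain ⟨p, hp, hfp⟩ := hB.exists_repr_on_hilbertSubspace hPN horth hP hN f
  obtain ⟨n, hn, hfn⟩ := hB.neg.exists_repr_on_hilbertSubspace hPN.symm
    (fun x hx y hy => neg_eq_zero.2 (horth' x hx y hy)) hN (by rwa [neg_neg]) f
  refine ⟨p - n, fun x => ?_⟩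
  obtain ⟨a, b, ha, hb, rfl⟩ := Submodule.codisjoint_iff_exists_add_eq.1 hPN.codisjoint x
  simp [hfp a ha, hfn b hb, horth p hp b hb, horth' n hn a ha, sub_eq_add_neg]

theorem IsKreinForm.eq_zero_of_forall (hB : IsKreinForm B) {z : K} (h : ∀ x, B x z = 0) :
    z = 0 := by
  obtain ⟨P, N, hPN, horth, hP, hN⟩ := hB.decomposition
  obtain ⟨p, n, hp, hn, rfl⟩ := Submodule.codisjoint_iff_exists_add_eq.1 hPN.codisjoint z
  have hpp : B p p = 0 := by
    simpa only [map_add, horth p hp n hn, add_zero] using h p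
  have hnn : B n n = 0 := by
    simpa only [map_add, hB.hermitian p n, horth p hp n hn, map_zero, zero_add] using h n
  rw [hP.eq_zero hp hpp, hN.eq_zero hn (by simp [hnn]), add_zero]

theorem IsKreinForm.eq_zero_of_dense (hB : IsKreinForm B) {D : Set K} (hD : Dense D) {z : K}
    (h : ∀ x ∈ D, B x z = 0) : z = 0 :=
  hB.eq_zero_of_forall fun x => congrFun
    ((hB.continuous.comp (Continuous.prodMk_left z)).ext_on hD continuous_const h) x

theorem IsKreinForm.dense_of_orthogonal [CompleteSpace K] (hB : IsKreinForm B)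
    (M : Submodule ℂ K) (h : ∀ y, (∀ x ∈ M, B y x = 0) → y = 0) : Dense (M : Set K) := by
  rw [Submodule.dense_iff_topologicalClosure_eq_top, Submodule.eq_top_iff']
  intro x
  have : IsClosed (M.topologicalClosure : Set K) := M.isClosed_topologicalClosure
  rw [← Submodule.Quotient.mk_eq_zero]
  refine SeparatingDual.eq_zero_of_forall_dual_eq_zero (R := ℂ) fun g => ?_
  obtain ⟨y, hy⟩ := hB.exists_repr (g ∘L M.topologicalClosure.mkQL)
  have hy0 : y = 0 := h y fun w hw => by
    have hw0 : M.topologicalClosure.mkQL w = 0 :=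
      (Submodule.Quotient.mk_eq_zero _).2 (M.le_topologicalClosure hw)
    rw [← hy w, ContinuousLinearMap.comp_apply, hw0, map_zero]
  have hx := hy x
  rwa [hy0, map_zero] at hx

/-! ### Adjoints -/

variable {A T : K →ₗ.[ℂ] K} {z : ℂ}

theorem IsKreinForm.graph_adjoint (hB : IsKreinForm B) (hT : Dense (T.domain : Set K)) :
    (adjoint B T).graph = adjointGraph B T := by
  refine Submodule.toLinearPMap_graph_eq _ fun p hp hp0 => hB.eq_zero_of_dense hT fun x hx => ?_
  have hxp : B (T ⟨x, hx⟩) p.1 = B x p.2 := hp ⟨x, hx⟩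
  rw [← hxp, hp0, map_zero]

theorem IsKreinForm.isClosed_adjoint (hB : IsKreinForm B) (hT : Dense (T.domain : Set K)) :
    (adjoint B T).IsClosed := by
  have hgraph : (adjointGraph B T : Set (K × K)) = ⋂ x : T.domain, {p | B (T x) p.1 = B x p.2} :=
    Set.ofPred_forall _
  rw [LinearPMap.IsClosed, hB.graph_adjoint hT, hgraph]
  exact isClosed_iInter fun x => isClosed_eq
    (hB.continuous.comp (continuous_const.prodMk continuous_fst))
    (hB.continuous.comp (continuous_const.prodMk continuous_snd))

theorem IsKreinForm.isFormalAdjoint_adjoint (hB : IsKreinForm B)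
    (hT : Dense (T.domain : Set K)) : IsFormalAdjoint B T (adjoint B T) := fun x y => by
  have hy : ((y : K), adjoint B T y) ∈ adjointGraph B T :=
    hB.graph_adjoint hT ▸ (adjoint B T).mem_graph y
  exact hy x

theorem IsFormalAdjoint.dense_domain [CompleteSpace K] (hB : IsKreinForm B)
    (hA : IsFormalAdjoint B A A) (hz : z ∈ resolventSet A)
    (hz' : (starRingEnd ℂ) z ∈ resolventSet A) : Dense (A.domain : Set K) := by
  obtain ⟨R, hR⟩ := hz
  obtain ⟨R', hR'⟩ := hz'
  refine hB.dense_of_orthogonal _ fun y hy => ?_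
  have hRy : R y = 0 := hB.eq_zero_of_forall fun x => by
    have hyx : B (R' x) y = 0 := by
      rw [hB.hermitian y, hy _ (LinearPMap.mem_domain_of_mem_graph (hR'.mem_graph x)), map_zero]
    simpa [hyx] using hA.apply_eq_of_mem_graph (hR'.mem_graph x) (hR.mem_graph y)
  have hy0 := hR.mem_graph y
  rw [hRy, smul_zero, add_zero] at hy0
  exact A.graph_fst_eq_zero_snd hy0 rfl

theorem IsFormalAdjoint.adjointGraph_le (hB : IsKreinForm B) (hA : IsFormalAdjoint B A A)
    (hz : z ∈ resolventSet A) (hz' : (starRingEnd ℂ) z ∈ resolventSet A) :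
    adjointGraph B A ≤ A.graph := by
  obtain ⟨R, hR⟩ := hz
  obtain ⟨R', hR'⟩ := hz'
  rintro ⟨y, w⟩ hyw
  have hgraph := hR'.mem_graph (w - (starRingEnd ℂ) z • y)
  have hy : y - R' (w - (starRingEnd ℂ) z • y) = 0 := hB.eq_zero_of_forall fun x => by
    have hadj : B (x + z • R x) y = B (R x) w := by
      obtain ⟨a, ha, hAa⟩ := (LinearPMap.mem_graph_iff _).1 (hR.mem_graph x)
      simpa only [ha, hAa] using hyw a
    have hsymm := hA.apply_eq_of_mem_graph (hR.mem_graph x) hgraph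
    simp only [map_add, map_sub, map_smul, map_smulₛₗ, LinearMap.add_apply,
      LinearMap.smul_apply, smul_eq_mul] at hadj hsymm ⊢
    linear_combination hadj - hsymm
  rw [← sub_eq_zero.1 hy, sub_add_cancel] at hgraph
  exact hgraph

theorem IsFormalAdjoint.isSelfadjoint [CompleteSpace K] (hB : IsKreinForm B)
    (hA : IsFormalAdjoint B A A) (hz : z ∈ resolventSet A)
    (hz' : (starRingEnd ℂ) z ∈ resolventSet A) : IsSelfadjoint B A := by
  have hdense := hA.dense_domain hB hz hz'
  refine ⟨hdense, LinearPMap.eq_of_eq_graph ?_⟩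
  rw [hB.graph_adjoint hdense]
  refine (hA.adjointGraph_le hB hz hz').antisymm ?_
  rintro ⟨y, w⟩ hyw x
  exact hA.apply_eq_of_mem_graph (A.mem_graph x) hyw

end KreinSpace

/-! ### The extended real line -/

theorem locallyConnectedSpace_onePoint (V : Type*) [AddCommGroup V] [Module ℝ V]
    [FiniteDimensional ℝ V] [TopologicalSpace V] [IsTopologicalAddGroup V] [ContinuousSMul ℝ V]
    [T2Space V] : LocallyConnectedSpace (OnePoint V) := by
  let n := Module.finrank ℝ V
  have : Fact (Module.finrank ℝ (EuclideanSpace ℝ (Fin (n + 1))) = n + 1) := ⟨by simp⟩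
  have : LocallyConnectedSpace (Metric.sphere (0 : EuclideanSpace ℝ (Fin (n + 1))) 1) :=
    ChartedSpace.locallyConnectedSpace (EuclideanSpace ℝ (Fin n)) _
  have hcard : n + 1 = Fintype.card (Fin (n + 1)) := (Fintype.card_fin _).symm
  exact (onePointEquivSphereOfFinrankEq hcard).locallyConnectedSpace

theorem exists_isConnected_disjoint_diff_singleton {X : Type*} [TopologicalSpace X] [T1Space X]
    [LocallyConnectedSpace X] {F I : Set X} {p : X} (hF : F.Finite) (hI : IsOpen I)
    (hp : p ∈ I) : ∃ J ⊆ I, IsOpen J ∧ IsConnected J ∧ p ∈ J ∧ Disjoint (J \ {p}) F := by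
  have hopen : IsOpen (I \ (F \ {p})) := hI.sdiff hF.sdiff.isClosed
  have hmem : p ∈ I \ (F \ {p}) := ⟨hp, fun h => h.2 rfl⟩
  have hsub := connectedComponentIn_subset (I \ (F \ {p})) p
  exact ⟨connectedComponentIn (I \ (F \ {p})) p, hsub.trans Set.sdiff_subset,
    hopen.connectedComponentIn, isConnected_connectedComponentIn_iff.2 hmem,
    mem_connectedComponentIn hmem,
    Set.disjoint_left.2 fun x hx hxF => (hsub hx.1).2 ⟨hxF, hx.2⟩⟩

theorem mul_pos_of_isPreconnected {s : Set (OnePoint ℝ)} (hs : IsPreconnected s)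
    (hdisj : Disjoint s {((0 : ℝ) : OnePoint ℝ), OnePoint.infty}) {a b : ℝ}
    (ha : (a : OnePoint ℝ) ∈ s) (hb : (b : OnePoint ℝ) ∈ s) : 0 < a * b := by
  have h0 : ((0 : ℝ) : OnePoint ℝ) ∉ s := Set.disjoint_right.1 hdisj (Set.mem_insert _ _)
  have hinf : OnePoint.infty ∉ s := Set.disjoint_right.1 hdisj (Set.mem_insert_of_mem _ rfl)
  have hrange : s ⊆ Set.range ((↑) : ℝ → OnePoint ℝ) := fun x hx =>
    OnePoint.ne_infty_iff_exists.1 (ne_of_mem_of_not_mem hx hinf)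
  have hpre : IsPreconnected (((↑) : ℝ → OnePoint ℝ) ⁻¹' s) :=
    hs.preimage_of_isOpenMap OnePoint.coe_injective OnePoint.isOpenEmbedding_coe.isOpenMap hrange
  by_contra! hab
  rcases mul_nonpos_iff.1 hab with ⟨ha0, hb0⟩ | ⟨ha0, hb0⟩
  · exact h0 (hpre.Icc_subset hb ha ⟨hb0, ha0⟩)
  · exact h0 (hpre.Icc_subset ha hb ⟨ha0, hb0⟩)

theorem coe_mem_range_extReal_iff {z : ℂ} : (z : OnePoint ℂ) ∈ Set.range extReal ↔ z.im = 0 := by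
  constructor
  · rintro ⟨p, hp⟩
    induction p using OnePoint.rec with
    | infty => exact absurd hp (OnePoint.infty_ne_coe z)
    | coe t => rw [← OnePoint.coe_injective hp, Complex.ofReal_im]
  · intro h
    exact ⟨(z.re : ℝ), congrArg ((↑) : ℂ → OnePoint ℂ) (Complex.ext rfl h.symm)⟩

theorem ne_zero_of_notMem_range_extReal {z : ℂ} (hz : (z : OnePoint ℂ) ∉ Set.range extReal) :
    z ≠ 0 := by
  rintro rfl
  exact hz (coe_mem_range_extReal_iff.2 Complex.zero_im)

/-! ### Definitizability of `S T` and `T S` -/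

variable {A T S : K →ₗ.[ℂ] K} {B : K →ₗ⋆[ℂ] K →ₗ[ℂ] ℂ} {Ω : Set (OnePoint ℂ)}

theorem IsDefinitizableOver.exists_conj_mem_resolventSet (hA : IsDefinitizableOver B A Ω)
    (hΩ : ∃ t : ℝ, ((t : ℂ) : OnePoint ℂ) ∈ Ω) :
    ∃ z : ℂ, z ≠ 0 ∧ z ∈ resolventSet A ∧ starRingEnd ℂ z ∈ resolventSet A := by
  obtain ⟨t, ht⟩ := hΩ
  obtain ⟨U, hU, htU, m, -, M, -, hUρ⟩ := hA.growth {((t : ℂ) : OnePoint ℂ)} isClosed_singleton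
    (Set.singleton_subset_iff.2 ⟨ht, (t : OnePoint ℝ), rfl⟩)
  obtain ⟨ε, hε, hball⟩ := Metric.isOpen_iff.1 (hU.preimage OnePoint.continuous_coe) (t : ℂ)
    (htU rfl)
  have hρ : ∀ z : ℂ, ‖z - t‖ < ε → z.im ≠ 0 → z ∈ resolventSet A := fun z hz him =>
    (hUρ z ⟨hball (mem_ball_iff_norm.2 hz), fun h => him (coe_mem_range_extReal_iff.1 h)⟩).1
  set z : ℂ := t + (ε / 2 : ℝ) * Complex.I with hz
  have him : z.im = ε / 2 := by simp [hz]
  have hdist : ‖z - t‖ < ε := by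
    rw [hz, add_sub_cancel_left, norm_mul, Complex.norm_I, mul_one, Complex.norm_real,
      Real.norm_of_nonneg (half_pos hε).le]
    exact half_lt_self hε
  have him0 : z.im ≠ 0 := him ▸ (half_pos hε).ne'
  refine ⟨z, fun h => him0 (by rw [h, Complex.zero_im]), hρ z hdist him0, hρ _ ?_ ?_⟩
  · rwa [← Complex.conj_ofReal t, ← map_sub, Complex.norm_conj]
  · rwa [Complex.conj_im, neg_ne_zero]

theorem ResolventFactors.image_spectrum_inter_eq (h : ResolventFactors T S)
    {W : Set (OnePoint ℂ)} (hW : ((0 : ℂ) : OnePoint ℂ) ∉ W) :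
    ((↑) : ℂ → OnePoint ℂ) '' spectrum (mul T S) ∩ W = (↑) '' spectrum (mul S T) ∩ W := by
  ext w
  refine and_congr_left fun hw => exists_congr fun z => and_congr_left ?_
  rintro rfl
  exact h.mem_spectrum_iff fun h0 => hW (h0 ▸ hw)

theorem ResolventFactors.exists_definite_neighborhood (h : ResolventFactors T S)
    (hB : IsKreinForm B) (hTS : IsFormalAdjoint B T S) {p : OnePoint ℝ} {I : Set (OnePoint ℝ)}
    (hI : IsOpen I) (hp : p ∈ I)
    (hdef : ∀ q ∈ I \ {p}, IsOfDefiniteType B (mul S T)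
      {z : ℂ | ∃ t : ℝ, (t : ℂ) = z ∧ (t : OnePoint ℝ) ∈ connectedComponentIn (I \ {p}) q}) :
    ∃ J : Set (OnePoint ℝ), IsOpen J ∧ IsConnected J ∧ p ∈ J ∧
      ∀ q ∈ J \ {p}, IsOfDefiniteType B (mul T S)
        {z : ℂ | ∃ t : ℝ, (t : ℂ) = z ∧ (t : OnePoint ℝ) ∈ connectedComponentIn (J \ {p}) q} := by
  have := locallyConnectedSpace_onePoint ℝ
  obtain ⟨J, hJI, hJ, hJc, hpJ, hJdisj⟩ := exists_isConnected_disjoint_diff_singleton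
    (Set.toFinite {((0 : ℝ) : OnePoint ℝ), OnePoint.infty}) hI hp
  refine ⟨J, hJ, hJc, hpJ, fun q hq => ?_⟩
  have hpunct : J \ {p} ⊆ I \ {p} := Set.sdiff_subset_sdiff_left hJI
  have himage : ∀ D : Set (OnePoint ℝ), {z : ℂ | ∃ t : ℝ, (t : ℂ) = z ∧ (t : OnePoint ℝ) ∈ D} =
      (↑) '' {t : ℝ | (t : OnePoint ℝ) ∈ D} := fun D =>
    Set.ext fun z => exists_congr fun t => and_comm
  have hsign : ∀ a b : ℝ, (a : OnePoint ℝ) ∈ connectedComponentIn (J \ {p}) q →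
      (b : OnePoint ℝ) ∈ connectedComponentIn (J \ {p}) q → 0 < a * b := fun a b =>
    mul_pos_of_isPreconnected isPreconnected_connectedComponentIn
      (hJdisj.mono_left (connectedComponentIn_subset _ _))
  have hdefI := hdef q (hpunct hq)
  rw [himage] at hdefI ⊢
  exact h.isOfDefiniteType hB hTS (fun a ha b hb => hsign a b ha hb)
    (hdefI.mono (Set.image_mono fun _ ht => connectedComponentIn_mono q hpunct ht))

theorem IsDefinitizableOver.swap [CompleteSpace K] (hA : IsDefinitizableOver B (mul S T) Ω)
    (h : ResolventFactors T S) (hB : IsKreinForm B) (hTS : IsFormalAdjoint B T S)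
    (hΩ : ∃ t : ℝ, ((t : ℂ) : OnePoint ℂ) ∈ Ω) : IsDefinitizableOver B (mul T S) Ω where
  selfadjoint := by
    obtain ⟨z, hz, hzρ, hzρ'⟩ := hA.exists_conj_mem_resolventSet hΩ
    exact ((hTS.symm hB).mul_self hB).isSelfadjoint hB ((h.mem_resolventSet_iff hz).2 hzρ)
      ((h.mem_resolventSet_iff ((map_ne_zero _).2 hz)).2 hzρ')
  no_accPt p hp := by
    rw [h.image_spectrum_inter_eq fun h0 => ne_zero_of_notMem_range_extReal h0.2 rfl]
    exact hA.no_accPt p hp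
  poles z hzσ hzΩ := by
    have hz : z ≠ 0 := ne_zero_of_notMem_range_extReal hzΩ.2
    exact h.isResolventPole hz (hA.poles z ((h.mem_spectrum_iff hz).1 hzσ) hzΩ)
  growth Δ hΔ hΔΩ := by
    obtain ⟨U, hU, hΔU, m, hm, M, hM, hgrowth⟩ := hA.growth Δ hΔ hΔΩ
    obtain ⟨M', hM', hle⟩ := h.exists_norm_resolvent_le hm hM
    refine ⟨U, hU, hΔU, m + 1, Nat.le_add_left 1 m, M', hM', fun z hz => ?_⟩
    obtain ⟨hρ, hzM⟩ := hgrowth z hz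
    exact ⟨(h.mem_resolventSet_iff (ne_zero_of_notMem_range_extReal hz.2)).2 hρ,
      hle z (fun h0 => hz.2 (coe_mem_range_extReal_iff.2 h0)) hρ hzM⟩
  definite p hp := by
    obtain ⟨I, hI, -, hpI, hdef⟩ := hA.definite p hp
    exact h.exists_definite_neighborhood hB hTS hI hpI hdef

end Krein

theorem theoremt_general {K : Type*} [NormedAddCommGroup K] [NormedSpace ℂ K] [CompleteSpace K]
    {B : K →ₗ⋆[ℂ] K →ₗ[ℂ] ℂ} (hB : Krein.IsKreinForm B) {T S : K →ₗ.[ℂ] K}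
    (hT : T.IsClosable) (hS : S.IsClosable) (hTS : Krein.IsFormalAdjoint B T S)
    (h₁ : (Krein.resolventSet (Krein.mul S T)).Nonempty)
    (h₂ : (Krein.resolventSet (Krein.mul T S)).Nonempty)
    {Ω : Set (OnePoint ℂ)} (hΩ : ∃ t : ℝ, ((t : ℂ) : OnePoint ℂ) ∈ Ω) :
    Krein.IsDefinitizableOver B (Krein.mul S T) Ω ↔
      Krein.IsDefinitizableOver B (Krein.mul T S) Ω := by
  obtain ⟨h⟩ := Krein.nonempty_resolventFactors hT hS h₁ h₂
  exact ⟨fun hA => hA.swap h hB hTS hΩ, fun hA => hA.swap h.symm hB (hTS.symm hB) hΩ⟩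

theorem theoremt {K : Type*} [NormedAddCommGroup K] [NormedSpace ℂ K] [CompleteSpace K]
    (B : K →ₗ⋆[ℂ] K →ₗ[ℂ] ℂ) (hB : Krein.IsKreinForm B)
    (T : K →ₗ.[ℂ] K) (hT_closed : T.IsClosed) (hT_dense : Dense (T.domain : Set K))
    (h₁ : (Krein.resolventSet (Krein.mul (Krein.adjoint B T) T)).Nonempty)
    (h₂ : (Krein.resolventSet (Krein.mul T (Krein.adjoint B T))).Nonempty)
    (Ω : Set (OnePoint ℂ)) (hΩ : Krein.IsAdmissibleDomain Ω) :
    Krein.IsDefinitizableOver B (Krein.mul (Krein.adjoint B T) T) Ω ↔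
      Krein.IsDefinitizableOver B (Krein.mul T (Krein.adjoint B T)) Ω :=
  theoremt_general hB hT_closed.isClosable (hB.isClosed_adjoint hT_dense).isClosable
    (hB.isFormalAdjoint_adjoint hT_dense) h₁ h₂ hΩ.meets_real
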